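/- Let $n \ge 1$, let $x \in \mathbb{R}^n$ be a nonzero vector, let $\delta > 0$, and let $x_0 \in \mathbb{R}^n$ satisfy $\|x_0 - x\|_2 \le \delta \|x\|_2$. Let $a_1, a_2, \ldots$ be independent random vectors, each distributed uniformly on the unit sphere $S^{n-1} \subset \mathbb{R}^n$. Define the randomized Kaczmarz iterates for phase retrieval by $X_0 = x_0$ and $$X_{k+1} = X_k + \big(\operatorname{sign}(\langle a_{k+1}, X_k\rangle)\,|\langle a_{k+1}, x\rangle| - \langle a_{k+1}, X_k\rangle\big)\, a_{k+1}, \qquad k \ge 0,$$ where $\operatorname{sign}(0)=0$. Let $B \subset \mathbb{R}^n$ be the set of nonzero vectors whose angle with $x$ is at most $\pi/8$, and let $$\tau = \min\{k \ge 0 : X_k \notin B\},$$ with $\tau = \infty$ if $X_k \in B$ for all $k \ge 0$. Put $\alpha_\sigma = \frac12 - \frac{4\sin(\pi/8)}{\pi}$. Then $\alpha_\sigma > 0$, for every integer $k \ge 0$ $$\mathbb{E}\big[\|X_k - x\|_2^2\, 1_{\{\tau = \infty\}}\big] \le \Big(1 - \frac{\alpha_\sigma}{n}\Big)^k \|x_0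 - x\|_2^2,$$ and $$\mathbb{P}(\tau < \infty) \le \Big(\frac{\delta}{\sin(\pi/8)}\Big)^2.$$ -/

import Mathlib

open MeasureTheory ProbabilityTheory

noncomputable section

namespace Kaczmarz

/-- The Euclidean space `ℝⁿ`. -/
abbrev Vec (n : ℕ) : Type := EuclideanSpace ℝ (Fin n)

/-- The unit sphere `S^{n-1}` of `ℝⁿ`. -/
abbrev USphere (n : ℕ) : Type := Metric.sphere (0 : Vec n) 1

/-- The uniform probability measure `σ` on `S^{n-1}`: the surface measure of the sphere,
normalized to have total mass one. -/
def sigma (n : ℕ) : Measure (USphere n) :=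
  ((volume : Measure (Vec n)).toSphere Set.univ)⁻¹ • (volume : Measure (Vec n)).toSphere

/-- One Kaczmarz update of the estimate `z` with sampling vector `a` and signal `x`:
`z + η a` with `η = sign ⟪a, z⟫ * |⟪a, x⟫| - ⟪a, z⟫`. -/
def update {n : ℕ} (x : Vec n) (a : USphere n) (z : Vec n) : Vec n :=
  z + (Real.sign (inner ℝ (a : Vec n) z) * |inner ℝ (a : Vec n) x|
        - inner ℝ (a : Vec n) z) • (a : Vec n)

/-- The randomized Kaczmarz iterates `X₀ = x₀`, `X_{k+1} = X_k + η a_{k+1}`. The sampling vectors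
are indexed from zero: `a k` is the one used in step `k + 1`. -/
def iterate {n : ℕ} {Ω : Type*} (x x₀ : Vec n) (a : ℕ → Ω → USphere n) : ℕ → Ω → Vec n
  | 0, _ => x₀
  | k + 1, ω => update x (a k ω) (iterate x x₀ a k ω)

/-- The basin `B` of points making an angle at most `π / 8` with `x`. The origin makes no angle
with `x` and is not in `B` (Mathlib's `angle` is `π / 2` there). -/
def basin {n : ℕ} (x : Vec n) : Set (Vec n) :=
  {z | InnerProductGeometry.angle z x ≤ Real.pi / 8}

/-- The exit time `τ = min {k ≥ 0 : X_k ∉ B}`, equal to `⊤` if all iterates lie in `B`. -/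
def exitTime {n : ℕ} {Ω : Type*} (x x₀ : Vec n) (a : ℕ → Ω → USphere n) : Ω → WithTop ℕ :=
  hittingAfter (iterate x x₀ a) (basin x)ᶜ 0

/-- The constant `α_σ = 1/2 - 4 sin(π/8) / π`. -/
def alphaSigma : ℝ := 1 / 2 - 4 * Real.sin (Real.pi / 8) / Real.pi

end Kaczmarz

end

/-! One step from `z` changes the squared error by `-⟪a, z - x⟫²`, of mean `-‖z - x‖² / n`, plus a
penalty that is `4⟪a, x⟫²` when the signs of `⟪a, z⟫` and `⟪a, x⟫` are opposite and vanishes when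
they agree and are nonzero. For `z` in the basin the mean penalty is at most `2‖z - x‖² / (3n)`
(`integral_sign_mul_abs_sub_sq_le`), so the expected squared error contracts by `1 - 1 / (3n)`,
which suffices because `alphaSigma ≤ 1 / 3`.

The penalty bound uses only the invariance of `sigma` under isometries. Write `x = w + c z` with `w
⟂ z`. Symmetrizing under `z ↦ -z` bounds the penalty by a `wedge` function of `⟪a, w⟫` and `⟪a, z⟫`;
averaging six rotated or reflected copies of the wedge bounds its integral without computing any
density.

Freezing the iterates outside the basin makes the error a nonnegative supermartingale. With the
indicator of the basin attached it decays geometrically, which gives the first estimate. Since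
points outside the basin lie at distance at least `sin(π/8)‖x‖` from `x`, Markov's inequality gives
the second. -/

namespace Kaczmarz

/-! ### Isometry invariance and second moments of the uniform measure on the sphere. -/

section Sphere

variable {n : ℕ}

/-- The action of a linear isometry on the unit sphere. -/
noncomputable def sphereEquiv (L : Vec n ≃ₗᵢ[ℝ] Vec n) : USphere n ≃ᵐ USphere n where
  toFun a := ⟨L a, mem_sphere_zero_iff_norm.2 ((L.norm_map a).trans (norm_eq_of_mem_sphere a))⟩
  invFun a := ⟨L.symm a,
    mem_sphere_zero_iff_norm.2 ((L.symm.norm_map a).trans (norm_eq_of_mem_sphere a))⟩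
  left_inv a := Subtype.ext (L.symm_apply_apply a)
  right_inv a := Subtype.ext (L.apply_symm_apply a)
  measurable_toFun := (L.continuous.measurable.comp measurable_subtype_coe).subtype_mk
  measurable_invFun := (L.symm.continuous.measurable.comp measurable_subtype_coe).subtype_mk

@[simp]
lemma coe_sphereEquiv (L : Vec n ≃ₗᵢ[ℝ] Vec n) (a : USphere n) :
    (sphereEquiv L a : Vec n) = L a := rfl

open scoped Pointwise in
lemma map_sphereEquiv_toSphere (L : Vec n ≃ₗᵢ[ℝ] Vec n) :
    ((volume : Measure (Vec n)).toSphere).map (sphereEquiv L) =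
      (volume : Measure (Vec n)).toSphere := by
  ext s hs
  rw [(sphereEquiv L).map_apply, Measure.toSphere_apply' _ ((sphereEquiv L).measurable hs),
    Measure.toSphere_apply' _ hs]
  congr 1
  have h : Set.Ioo (0 : ℝ) 1 • ((↑) '' (sphereEquiv L ⁻¹' s) : Set (Vec n)) =
      L.toMeasurableEquiv ⁻¹' (Set.Ioo (0 : ℝ) 1 • ((↑) '' s)) := by
    ext v
    simp only [Set.mem_smul, Set.mem_preimage, Set.mem_image]
    constructor
    · rintro ⟨r, hr, _, ⟨b, hb, rfl⟩, rfl⟩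
      exact ⟨r, hr, _, ⟨_, hb, rfl⟩, by simp⟩
    · rintro ⟨r, hr, _, ⟨b, hb, rfl⟩, h⟩
      refine ⟨r, hr, _, ⟨(sphereEquiv L).symm b, by simpa using hb, rfl⟩, ?_⟩
      apply L.injective
      have h' : L ((sphereEquiv L).symm b : Vec n) = b := by
        rw [← coe_sphereEquiv, MeasurableEquiv.apply_symm_apply]
      rw [map_smul, h', h]
      rfl
  rw [h]
  exact (L.measurePreserving.measure_preimage_equiv (f := L.toMeasurableEquiv) _)

lemma measurePreserving_sphereEquiv (L : Vec n ≃ₗᵢ[ℝ] Vec n) :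
    MeasurePreserving (sphereEquiv L) (sigma n) (sigma n) := by
  refine ⟨(sphereEquiv L).measurable, ?_⟩
  rw [sigma, Measure.map_smul, map_sphereEquiv_toSphere]

lemma isProbabilityMeasure_sigma (hn : n ≠ 0) : IsProbabilityMeasure (sigma n) := by
  constructor
  have h : (volume : Measure (Vec n)).toSphere Set.univ ≠ 0 := by
    rw [ne_eq, Measure.measure_univ_eq_zero, Measure.toSphere_eq_zero_iff_finrank]
    simpa using hn
  rw [sigma, Measure.smul_apply, smul_eq_mul, ENNReal.inv_mul_cancel h (measure_ne_top _ _)]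

/-- Two reflections suffice: one takes `s` to `s'`, the next takes `R t` to `t'`. The second fixes
`s'`, because equality of the inner products makes `s'` orthogonal to `R t - t'`. -/
lemma exists_isometry_map_pair {s t s' t' : Vec n} (hs : ‖s‖ = ‖s'‖) (ht : ‖t‖ = ‖t'‖)
    (hst : inner ℝ s t = inner ℝ s' t') :
    ∃ L : Vec n ≃ₗᵢ[ℝ] Vec n, L s = s' ∧ L t = t' := by
  obtain ⟨R, hR⟩ : ∃ R : Vec n ≃ₗᵢ[ℝ] Vec n, R s = s' := ⟨_, Submodule.reflection_sub hs⟩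
  have h1 : ‖R t‖ = ‖t'‖ := by simpa using ht
  refine ⟨R.trans (ℝ ∙ (R t - t'))ᗮ.reflection, ?_, ?_⟩
  · rw [LinearIsometryEquiv.trans_apply, hR]
    apply Submodule.reflection_mem_subspace_eq_self
    rw [Submodule.mem_orthogonal_singleton_iff_inner_left, inner_sub_right, ← hst, ← hR,
      R.inner_map_map, sub_self]
  · rw [LinearIsometryEquiv.trans_apply, Submodule.reflection_sub h1]

lemma integral_inner_pair_congr (F : ℝ → ℝ → ℝ) {s t s' t' : Vec n} (hs : ‖s‖ = ‖s'‖)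
    (ht : ‖t‖ = ‖t'‖) (hst : inner ℝ s t = inner ℝ s' t') :
    ∫ a, F (inner ℝ (a : Vec n) s) (inner ℝ (a : Vec n) t) ∂sigma n =
      ∫ a, F (inner ℝ (a : Vec n) s') (inner ℝ (a : Vec n) t') ∂sigma n := by
  obtain ⟨L, rfl, rfl⟩ := exists_isometry_map_pair hs ht hst
  rw [← (measurePreserving_sphereEquiv L).integral_comp' (g := fun a : USphere n =>
    F (inner ℝ (a : Vec n) (L s)) (inner ℝ (a : Vec n) (L t)))]
  simp

lemma integrable_sigma_of_continuous (hn : n ≠ 0) {f : USphere n → ℝ} (hf : Continuous f) :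
    Integrable f (sigma n) := by
  have := isProbabilityMeasure_sigma hn
  exact hf.integrable_of_hasCompactSupport (HasCompactSupport.of_compactSpace f)

/-- By invariance `v` may be replaced by `‖v‖ • e i` for each `i`, and the squared coordinates of a
unit vector sum to one. -/
lemma integral_inner_sq (hn : n ≠ 0) (v : Vec n) :
    ∫ a, (inner ℝ (a : Vec n) v) ^ 2 ∂sigma n = ‖v‖ ^ 2 / n := by
  have := isProbabilityMeasure_sigma hn
  let e := EuclideanSpace.basisFun (Fin n) ℝ
  have h (i : Fin n) : ∫ a, (inner ℝ (a : Vec n) (‖v‖ • e i)) ^ 2 ∂sigma n =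
      ∫ a, (inner ℝ (a : Vec n) v) ^ 2 ∂sigma n :=
    integral_inner_pair_congr (fun p _ => p ^ 2) (t := 0) (t' := 0)
      (by simp [norm_smul]) rfl (by simp)
  have hsum : ∑ i, ∫ a, (inner ℝ (a : Vec n) (‖v‖ • e i)) ^ 2 ∂sigma n = ‖v‖ ^ 2 := by
    rw [← integral_finsetSum _ fun i _ => integrable_sigma_of_continuous hn (by fun_prop)]
    have (a : USphere n) : ∑ i, (inner ℝ (a : Vec n) (‖v‖ • e i)) ^ 2 = ‖v‖ ^ 2 := by
      simp_rw [inner_smul_right, mul_pow]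
      rw [← Finset.mul_sum, e.sum_sq_inner_left]
      simp
    simp [this]
  simp_rw [h] at hsum
  simp only [Finset.sum_const, Finset.card_univ, Fintype.card_fin, nsmul_eq_mul] at hsum
  field_simp
  linarith

end Sphere

/-! ### A planar wedge inequality and its average over the sphere. -/

section Wedge

/-- The squared excess of `|s|` over `√3 |t|`: a function of a planar vector supported in the cone
of half-angle `π / 6` about the first axis. -/
noncomputable def wedge (s t : ℝ) : ℝ := max (|s| - √3 * |t|) 0 ^ 2

/-- The six wedges have axes at the multiples of `π / 6`, so at most two are nonzero at any point.
At angle `ψ ∈ [0, π/6]` from one of the two nearest axes, they add up to `4 (sin²(π/6 - ψ) + sin²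
ψ)` times the squared radius; this factor is at most one, with equality on the axes. -/
lemma sum_wedge_le_aux {u v : ℝ} (hv : 0 ≤ v) (h : v ≤ u) :
    wedge u v + wedge v u
      + wedge ((√3 * u + v) / 2) ((u - √3 * v) / 2)
      + wedge ((√3 * u - v) / 2) ((u + √3 * v) / 2)
      + wedge ((u + √3 * v) / 2) ((√3 * u - v) / 2)
      + wedge ((u - √3 * v) / 2) ((√3 * u + v) / 2) ≤ u ^ 2 + v ^ 2 := by
  have h3 : √3 * √3 = 3 := Real.mul_self_sqrt (by norm_num)
  have h31 : 1 ≤ √3 := Real.one_le_sqrt.2 (by norm_num)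
  have hu : 0 ≤ u := hv.trans h
  have huv : u ≤ √3 * u := le_mul_of_one_le_left hu h31
  have hvv : v ≤ √3 * v := le_mul_of_one_le_left hv h31
  have hvu : √3 * v ≤ √3 * u := by gcongr
  have e1 : |√3 * u + v| = √3 * u + v := abs_of_nonneg (by linarith)
  have e2 : |√3 * u - v| = √3 * u - v := abs_of_nonneg (by linarith)
  have e3 : |u + √3 * v| = u + √3 * v := abs_of_nonneg (by linarith)
  have a1 : √3 * (√3 * u) = 3 * u := by rw [← mul_assoc, h3]
  have a2 : √3 * (√3 * v) = 3 * v := by rw [← mul_assoc, h3]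
  simp only [wedge, abs_div, abs_two, e1, e2, e3, abs_of_nonneg hu, abs_of_nonneg hv]
  rw [max_eq_right (a := v - √3 * u) (by linarith),
    max_eq_right (a := (√3 * u - v) / 2 - √3 * ((u + √3 * v) / 2)) (by nlinarith)]
  -- The polar angle is at most `π / 6` in the first case, where the axes `0` and `π / 6`
  -- contribute, and lies in `[π / 6, π / 4]` in the second, where `π / 6` and `π / 3` do.
  rcases le_total (√3 * v) u with hc | hc
  · rw [abs_of_nonneg (by linarith : 0 ≤ u - √3 * v), max_eq_left (by linarith),
      max_eq_left (by nlinarith), max_eq_right (by nlinarith), max_eq_right (by nlinarith)]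
    nlinarith [mul_nonneg hv (sub_nonneg.2 hc)]
  · rw [abs_of_nonpos (by linarith : u - √3 * v ≤ 0), max_eq_right (by linarith),
      max_eq_left (by nlinarith), max_eq_left (by nlinarith), max_eq_right (by nlinarith)]
    nlinarith [mul_nonneg (by linarith : 0 ≤ √3 * u - v) (by nlinarith : 0 ≤ 3 * v - √3 * u)]

lemma wedge_neg_left (s t : ℝ) : wedge (-s) t = wedge s t := by simp [wedge]

lemma wedge_neg_right (s t : ℝ) : wedge s (-t) = wedge s t := by simp [wedge]

lemma sum_wedge_le (u v : ℝ) :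
    wedge u v + wedge v u
      + wedge ((√3 * u + v) / 2) ((u - √3 * v) / 2)
      + wedge ((√3 * u - v) / 2) ((u + √3 * v) / 2)
      + wedge ((u + √3 * v) / 2) ((√3 * u - v) / 2)
      + wedge ((u - √3 * v) / 2) ((√3 * u + v) / 2) ≤ u ^ 2 + v ^ 2 := by
  have hsign (u v : ℝ) (hu : 0 ≤ u) (hv : 0 ≤ v) :
    wedge u v + wedge v u
      + wedge ((√3 * u + v) / 2) ((u - √3 * v) / 2)
      + wedge ((√3 * u - v) / 2) ((u + √3 * v) / 2)
      + wedge ((u + √3 * v) / 2) ((√3 * u - v) / 2)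
      + wedge ((u - √3 * v) / 2) ((√3 * u + v) / 2) ≤ u ^ 2 + v ^ 2 := by
    rcases le_total v u with h | h
    · exact sum_wedge_le_aux hv h
    · have := sum_wedge_le_aux hu h
      rw [show (v - √3 * u) / 2 = -((√3 * u - v) / 2) by ring, add_comm (√3 * v) u,
        add_comm v (√3 * u)] at this
      rw [show (u - √3 * v) / 2 = -((√3 * v - u) / 2) by ring]
      simp only [wedge_neg_left, wedge_neg_right] at this ⊢
      linarith
  have hleft (u v : ℝ) (hv : 0 ≤ v) :
    wedge u v + wedge v u
      + wedge ((√3 * u + v) / 2) ((u - √3 * v) / 2)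
      + wedge ((√3 * u - v) / 2) ((u + √3 * v) / 2)
      + wedge ((u + √3 * v) / 2) ((√3 * u - v) / 2)
      + wedge ((u - √3 * v) / 2) ((√3 * u + v) / 2) ≤ u ^ 2 + v ^ 2 := by
    rcases le_total 0 u with h | h
    · exact hsign u v h hv
    · have := hsign (-u) v (by linarith) hv
      rw [show (√3 * -u + v) / 2 = -((√3 * u - v) / 2) by ring,
        show (-u - √3 * v) / 2 = -((u + √3 * v) / 2) by ring,
        show (√3 * -u - v) / 2 = -((√3 * u + v) / 2) by ring,
        show (-u + √3 * v) / 2 = -((u - √3 * v) / 2) by ring] at this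
      simp only [wedge_neg_left, wedge_neg_right] at this
      linarith
  rcases le_total 0 v with h | h
  · exact hleft u v h
  · have := hleft u (-v) (by linarith)
    rw [mul_neg, sub_neg_eq_add, sub_neg_eq_add, ← sub_eq_add_neg, ← sub_eq_add_neg] at this
    simp only [wedge_neg_left, wedge_neg_right] at this
    linarith

lemma continuous_wedge_comp {X : Type*} [TopologicalSpace X] {f g : X → ℝ} (hf : Continuous f)
    (hg : Continuous g) : Continuous fun a => wedge (f a) (g a) := by
  unfold wedge
  fun_prop

/-- The second moment of `wedge` on the sphere, bounded by averaging over the rotations of the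
plane `span {w, v}` by multiples of `π / 6`. -/
lemma integral_wedge_le {n : ℕ} (hn : n ≠ 0) {w v : Vec n} (hwv : inner ℝ w v = 0)
    (hnorm : ‖w‖ = ‖v‖) :
    ∫ a, wedge (inner ℝ (a : Vec n) w) (inner ℝ (a : Vec n) v) ∂sigma n ≤ ‖w‖ ^ 2 / (3 * n) := by
  have h3 : √3 * √3 = 3 := Real.mul_self_sqrt (by norm_num)
  have hvw : inner ℝ v w = 0 := by rw [real_inner_comm]; exact hwv
  have hww : inner ℝ w w = ‖w‖ ^ 2 := real_inner_self_eq_norm_sq w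
  have hvv : inner ℝ v v = ‖w‖ ^ 2 := by rw [hnorm]; exact real_inner_self_eq_norm_sq v
  have key (p q r s : ℝ) (h1 : p ^ 2 + q ^ 2 = 1) (h2 : r ^ 2 + s ^ 2 = 1)
      (hpq : p * r + q * s = 0) :
      ∫ a, wedge (p * inner ℝ (a : Vec n) w + q * inner ℝ (a : Vec n) v)
        (r * inner ℝ (a : Vec n) w + s * inner ℝ (a : Vec n) v) ∂sigma n =
      ∫ a, wedge (inner ℝ (a : Vec n) w) (inner ℝ (a : Vec n) v) ∂sigma n := by
    have hnrm (p q : ℝ) (h : p ^ 2 + q ^ 2 = 1) : ‖p • w + q • v‖ = ‖w‖ := by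
      rw [← sq_eq_sq₀ (norm_nonneg _) (norm_nonneg _), ← real_inner_self_eq_norm_sq]
      simp only [inner_add_left, inner_add_right, real_inner_smul_left, real_inner_smul_right,
        hwv, hvw, hww, hvv]
      linear_combination ‖w‖ ^ 2 * h
    have := integral_inner_pair_congr wedge (s := p • w + q • v) (t := r • w + s • v) (s' := w)
      (t' := v) (hnrm p q h1) ((hnrm r s h2).trans hnorm) (by
        simp only [inner_add_left, inner_add_right, real_inner_smul_left, real_inner_smul_right,
          hwv, hvw, hww, hvv]
        linear_combination ‖w‖ ^ 2 * hpq)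
    simpa only [inner_add_right, real_inner_smul_right] using this
  set I := ∫ a, wedge (inner ℝ (a : Vec n) w) (inner ℝ (a : Vec n) v) ∂sigma n
  let g (p q r s : ℝ) (a : USphere n) : ℝ :=
    wedge (p * inner ℝ (a : Vec n) w + q * inner ℝ (a : Vec n) v)
      (r * inner ℝ (a : Vec n) w + s * inner ℝ (a : Vec n) v)
  have hg (p q r s : ℝ) (h1 : p ^ 2 + q ^ 2 = 1) (h2 : r ^ 2 + s ^ 2 = 1)
      (hpq : p * r + q * s = 0) :
      Integrable (g p q r s) (sigma n) ∧ ∫ a, g p q r s a ∂sigma n = I :=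
    ⟨integrable_sigma_of_continuous hn (continuous_wedge_comp (by fun_prop) (by fun_prop)),
      key p q r s h1 h2 hpq⟩
  have hadd {f₁ f₂ : USphere n → ℝ} {x y : ℝ}
      (h₁ : Integrable f₁ (sigma n) ∧ ∫ a, f₁ a ∂sigma n = x)
      (h₂ : Integrable f₂ (sigma n) ∧ ∫ a, f₂ a ∂sigma n = y) :
      Integrable (fun a => f₁ a + f₂ a) (sigma n) ∧ ∫ a, f₁ a + f₂ a ∂sigma n = x + y :=
    ⟨h₁.1.add h₂.1, by rw [integral_add h₁.1 h₂.1, h₁.2, h₂.2]⟩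
  -- Some of these orthonormal frames are orientation-reversing, which is harmless as `wedge` is
  -- even in each variable.
  obtain ⟨hint, hval⟩ := hadd (hadd (hadd (hadd (hadd
    (hg 1 0 0 1 (by norm_num) (by norm_num) (by norm_num))
    (hg 0 1 1 0 (by norm_num) (by norm_num) (by norm_num)))
    (hg (√3 / 2) (1 / 2) (1 / 2) (-√3 / 2) (by linarith) (by linarith) (by ring)))
    (hg (√3 / 2) (-1 / 2) (1 / 2) (√3 / 2) (by linarith) (by linarith) (by ring)))
    (hg (1 / 2) (√3 / 2) (√3 / 2) (-1 / 2) (by linarith) (by linarith) (by ring)))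
    (hg (1 / 2) (-√3 / 2) (√3 / 2) (1 / 2) (by linarith) (by linarith) (by ring))
  have hsq (u : Vec n) : Integrable (fun a : USphere n => inner ℝ (a : Vec n) u ^ 2) (sigma n) ∧
      ∫ a, inner ℝ (a : Vec n) u ^ 2 ∂sigma n = ‖u‖ ^ 2 / n :=
    ⟨integrable_sigma_of_continuous hn (by fun_prop), integral_inner_sq hn u⟩
  obtain ⟨hint', hval'⟩ := hadd (hsq w) (hsq v)
  have hsum := integral_mono hint hint' (fun a => by
    refine le_of_eq_of_le ?_ (sum_wedge_le (inner ℝ (a : Vec n) w) (inner ℝ (a : Vec n) v))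
    simp only [g]
    ring_nf)
  rw [hval, hval', ← hnorm] at hsum
  have hn' : (0 : ℝ) < n := by positivity
  rw [show ‖w‖ ^ 2 / (3 * n) = (‖w‖ ^ 2 / n) / 3 by field_simp]
  linarith

end Wedge

/-! ### Expected error after a single update. -/

section Step

variable {n : ℕ}

lemma norm_update_sub_sq (x z : Vec n) (a : USphere n) :
    ‖update x a z - x‖ ^ 2 = ‖z - x‖ ^ 2 - inner ℝ (a : Vec n) (z - x) ^ 2 +
      (Real.sign (inner ℝ (a : Vec n) z) * |inner ℝ (a : Vec n) x| -
        inner ℝ (a : Vec n) x) ^ 2 := by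
  have ha : ‖(a : Vec n)‖ = 1 := norm_eq_of_mem_sphere a
  rw [update, add_sub_right_comm, norm_add_sq_real, real_inner_smul_right, norm_smul, ha,
    real_inner_comm (a : Vec n) (z - x), inner_sub_right, mul_one, Real.norm_eq_abs, sq_abs]
  ring

lemma sign_mul_abs_sub_sq_le (p q : ℝ) : (Real.sign q * |p| - p) ^ 2 ≤ 4 * p ^ 2 := by
  have h := sq_abs p
  rcases Real.sign_apply_eq q with hq | hq | hq <;> rw [hq] <;>
    cases abs_cases p <;> nlinarith [sq_nonneg p]

/-- Pairing the reconstruction errors at the points `u + c q` and `u - c q`, which lie in mirror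
images of the region where the two signs differ. -/
lemma sign_mul_abs_sub_sq_add_le {c : ℝ} (hc : 0 < c) (u q : ℝ) :
    (Real.sign q * |u + c * q| - (u + c * q)) ^ 2 +
      (Real.sign (-q) * |u + c * -q| - (u + c * -q)) ^ 2 ≤ 4 * max (|u| - c * |q|) 0 ^ 2 := by
  have hpos (u q : ℝ) (hq : 0 < q) : (Real.sign q * |u + c * q| - (u + c * q)) ^ 2 +
      (Real.sign (-q) * |u + c * -q| - (u + c * -q)) ^ 2 ≤ 4 * max (|u| - c * |q|) 0 ^ 2 := by
    have hcq : 0 < c * q := mul_pos hc hq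
    rw [Real.sign_of_pos hq, Real.sign_of_neg (neg_lt_zero.2 hq), abs_of_pos hq]
    rcases lt_or_ge (u + c * q) 0 with h1 | h1
    · rw [abs_of_neg h1, abs_of_neg (by linarith : u + c * -q < 0), abs_of_neg (by linarith : u < 0),
        max_eq_left (by linarith)]
      apply le_of_eq
      ring
    · rw [abs_of_nonneg h1]
      rcases lt_or_ge 0 (u + c * -q) with h2 | h2
      · rw [abs_of_pos h2, abs_of_pos (by linarith : 0 < u), max_eq_left (by linarith)]
        apply le_of_eq
        ring
      · rw [abs_of_nonpos h2]
        have := sq_nonneg (max (|u| - c * q) 0)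
        linarith
  rcases lt_trichotomy q 0 with hq | rfl | hq
  · have := hpos u (-q) (neg_pos.2 hq)
    rw [neg_neg, abs_neg] at this
    linarith
  -- Since `sign 0 = 0`, each error here is `u ^ 2`, and `2 * u ^ 2 ≤ 4 * u ^ 2`.
  · simp only [Real.sign_zero, mul_zero, neg_zero, abs_zero, sub_zero, max_eq_left (abs_nonneg u),
      sq_abs]
    nlinarith [sq_nonneg u]
  · exact hpos u q hq

lemma measurable_sign : Measurable Real.sign := by
  unfold Real.sign
  exact Measurable.ite measurableSet_Iio measurable_const
    (Measurable.ite measurableSet_Ioi measurable_const measurable_const)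

lemma measurable_update (x : Vec n) :
    Measurable fun y : Vec n × USphere n => update x y.2 y.1 := by
  have h : Measurable fun y : Vec n × USphere n => inner ℝ (y.2 : Vec n) y.1 :=
    Continuous.measurable (by fun_prop)
  have h' : Measurable fun y : Vec n × USphere n => |inner ℝ (y.2 : Vec n) x| :=
    Continuous.measurable (by fun_prop)
  unfold update
  exact measurable_fst.add ((((measurable_sign.comp h).mul h').sub h).smul
    (measurable_subtype_coe.comp measurable_snd))

lemma measurableSet_basin (x : Vec n) : MeasurableSet (basin x) := by
  have h : Measurable fun z : Vec n => InnerProductGeometry.angle z x := by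
    unfold InnerProductGeometry.angle
    exact Real.continuous_arccos.measurable.comp
      ((Continuous.measurable (by fun_prop)).div (Continuous.measurable (by fun_prop)))
  exact measurableSet_le h measurable_const

lemma integrable_sign_mul_abs_sub_sq (hn : n ≠ 0) (s t : Vec n) :
    Integrable (fun a : USphere n => (Real.sign (inner ℝ (a : Vec n) t) *
      |inner ℝ (a : Vec n) s| - inner ℝ (a : Vec n) s) ^ 2) (sigma n) := by
  have h (v : Vec n) : Measurable fun a : USphere n => inner ℝ (a : Vec n) v :=
    Continuous.measurable (by fun_prop)
  refine Integrable.mono' (integrable_sigma_of_continuous hn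
    (f := fun a => 4 * inner ℝ (a : Vec n) s ^ 2) (by fun_prop)) ?_ ?_
  · exact ((((measurable_sign.comp (h t)).mul (h s).abs).sub (h s)).pow_const 2).aestronglyMeasurable
  · refine Filter.Eventually.of_forall fun a => ?_
    rw [Real.norm_of_nonneg (sq_nonneg _)]
    exact sign_mul_abs_sub_sq_le _ _

lemma ne_zero_of_mem_basin {x z : Vec n} (hz : z ∈ basin x) : x ≠ 0 ∧ z ≠ 0 := by
  have hpi := Real.pi_pos
  constructor <;> rintro rfl <;> simp only [basin, Set.mem_ofPred_eq,
    InnerProductGeometry.angle_zero_left, InnerProductGeometry.angle_zero_right] at hz <;> linarith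

/-- The angle bound is relaxed from `π / 8` to `π / 6`, whose cosine `√3 / 2` matches the half-angle
of `wedge`. -/
lemma sq_inner_ge_of_mem_basin {x z : Vec n} (hz : z ∈ basin x) :
    0 < inner ℝ z x ∧ 3 * (‖z‖ * ‖x‖) ^ 2 ≤ 4 * inner ℝ z x ^ 2 := by
  obtain ⟨hx0, hz0⟩ := ne_zero_of_mem_basin hz
  have hpi := Real.pi_pos
  have hpos : 0 < ‖z‖ * ‖x‖ := mul_pos (norm_pos_iff.2 hz0) (norm_pos_iff.2 hx0)
  have hcos : √3 / 2 ≤ Real.cos (InnerProductGeometry.angle z x) := by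
    rw [← Real.cos_pi_div_six]
    exact Real.cos_le_cos_of_nonneg_of_le_pi (InnerProductGeometry.angle_nonneg _ _)
      (by linarith) (le_trans hz (by linarith))
  have h3 : √3 * √3 = 3 := Real.mul_self_sqrt (by norm_num)
  have h30 : 0 < √3 := by positivity
  rw [← InnerProductGeometry.cos_angle_mul_norm_mul_norm]
  refine ⟨mul_pos (by linarith) hpos, ?_⟩
  have : 3 ≤ 4 * Real.cos (InnerProductGeometry.angle z x) ^ 2 := by nlinarith
  rw [mul_pow (Real.cos _)]
  nlinarith [sq_nonneg (‖z‖ * ‖x‖)]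

/-- Completing the square in `‖z‖` leaves `sin²(π/8) ‖x‖²`, the squared distance from `x` to the
boundary of the cone. -/
lemma sin_mul_norm_le_of_notMem_basin {x z : Vec n} (hz : z ∉ basin x) :
    (Real.sin (Real.pi / 8) * ‖x‖) ^ 2 ≤ ‖z - x‖ ^ 2 := by
  have hpi := Real.pi_pos
  have hcos : Real.cos (InnerProductGeometry.angle z x) ≤ Real.cos (Real.pi / 8) :=
    Real.cos_le_cos_of_nonneg_of_le_pi (by positivity) (InnerProductGeometry.angle_le_pi _ _)
      (not_le.1 hz).le
  have h := Real.sin_sq_add_cos_sq (Real.pi / 8)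
  rw [norm_sub_sq_real, ← InnerProductGeometry.cos_angle_mul_norm_mul_norm]
  have h1 := mul_le_mul_of_nonneg_right hcos (mul_nonneg (norm_nonneg z) (norm_nonneg x))
  nlinarith [sq_nonneg (‖z‖ - Real.cos (Real.pi / 8) * ‖x‖), sq_nonneg ‖x‖]

/-- The mean error caused by wrong signs, for a point in the basin. -/
lemma integral_sign_mul_abs_sub_sq_le (hn : n ≠ 0) {x z : Vec n} (hz : z ∈ basin x) :
    ∫ a, (Real.sign (inner ℝ (a : Vec n) z) * |inner ℝ (a : Vec n) x| -
      inner ℝ (a : Vec n) x) ^ 2 ∂sigma n ≤ 2 / (3 * n) * ‖z - x‖ ^ 2 := by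
  obtain ⟨hx0, hz0⟩ := ne_zero_of_mem_basin hz
  obtain ⟨hzx, hcos⟩ := sq_inner_ge_of_mem_basin hz
  have hzn : 0 < ‖z‖ := norm_pos_iff.2 hz0
  set c : ℝ := inner ℝ z x / ‖z‖ ^ 2 with hc
  have hcpos : 0 < c := by positivity
  have hcz : c * ‖z‖ ^ 2 = inner ℝ z x := by rw [hc]; field_simp
  set w : Vec n := x - c • z with hw
  have hwz : inner ℝ w z = 0 := by
    rw [hw, inner_sub_left, real_inner_smul_left, real_inner_self_eq_norm_sq, hcz,
      real_inner_comm, sub_self]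
  have hwn : ‖w‖ ^ 2 = ‖x‖ ^ 2 - c * inner ℝ z x := by
    rw [hw, norm_sub_sq_real, real_inner_smul_right, norm_smul, Real.norm_eq_abs, mul_pow, sq_abs,
      real_inner_comm z x]
    linear_combination c * hcz
  -- `‖w‖` is the distance from `x` to the line through `z`.
  have hwle : ‖w‖ ^ 2 ≤ ‖z - x‖ ^ 2 := by
    rw [hwn, norm_sub_sq_real]
    have : ‖z‖ ^ 2 - 2 * inner ℝ z x + c * inner ℝ z x = ((1 - c) * ‖z‖) ^ 2 := by
      linear_combination (c - 2) * (-hcz)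
    nlinarith [sq_nonneg ((1 - c) * ‖z‖)]
  have hratio : √3 * ‖w‖ ≤ c * ‖z‖ := by
    rw [← sq_le_sq₀ (by positivity) (by positivity)]
    have h3 : √3 ^ 2 = 3 := Real.sq_sqrt (by norm_num)
    rw [mul_pow, mul_pow, h3, hwn]
    have h4 : c * inner ℝ z x = c ^ 2 * ‖z‖ ^ 2 := by linear_combination -c * hcz
    have h5 : 3 * ‖x‖ ^ 2 ≤ 4 * (c ^ 2 * ‖z‖ ^ 2) := by
      refine le_of_mul_le_mul_right ?_ (by positivity : 0 < ‖z‖ ^ 2)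
      calc 3 * ‖x‖ ^ 2 * ‖z‖ ^ 2 = 3 * (‖z‖ * ‖x‖) ^ 2 := by ring
        _ ≤ 4 * inner ℝ z x ^ 2 := hcos
        _ = _ := by rw [← hcz]; ring
    rw [h4]
    linarith
  -- Scaling by `r` gives `r • z` the norm of `w`, as `integral_wedge_le` requires; `√3 * r ≤ c` is
  -- the angle condition.
  set r : ℝ := ‖w‖ / ‖z‖ with hr
  have hr0 : 0 ≤ r := by positivity
  have hrc : √3 * r ≤ c := by
    rw [hr, ← mul_div_assoc, div_le_iff₀ hzn]
    exact hratio
  have hx (a : USphere n) : inner ℝ (a : Vec n) x =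
      inner ℝ (a : Vec n) w + c * inner ℝ (a : Vec n) z := by
    rw [hw, inner_sub_right, real_inner_smul_right]
    ring
  let F (s t : ℝ) : ℝ := (Real.sign t * |s + c * t| - (s + c * t)) ^ 2
  have hFint (t : Vec n) : Integrable (fun a : USphere n =>
      F (inner ℝ (a : Vec n) w) (inner ℝ (a : Vec n) t)) (sigma n) := by
    convert integrable_sign_mul_abs_sub_sq hn (w + c • t) t using 3 with a
    simp only [inner_add_right, real_inner_smul_right]
  -- The reflection fixing `w` and negating `z` preserves `sigma`, so twice the integral is that of
  -- the paired sum.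
  have hsymm := integral_inner_pair_congr F (s := w) (t := z) (s' := w) (t' := -z) rfl
    (norm_neg z).symm (by rw [inner_neg_right, hwz, neg_zero])
  have hle := integral_mono ((hFint z).add (hFint (-z)))
    (integrable_sigma_of_continuous hn (f := fun a => 4 * wedge (inner ℝ (a : Vec n) w)
      (inner ℝ (a : Vec n) (r • z)))
      (continuous_const.mul (continuous_wedge_comp (by fun_prop) (by fun_prop)))) (fun a => by
      simp only [Pi.add_apply, F, inner_neg_right, real_inner_smul_right]
      refine (sign_mul_abs_sub_sq_add_le hcpos _ _).trans ?_
      unfold wedge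
      rw [abs_mul, abs_of_nonneg hr0, ← mul_assoc]
      gcongr)
  have hwedge := integral_wedge_le hn (w := w) (v := r • z)
    (by rw [real_inner_smul_right, hwz, mul_zero])
    (by rw [norm_smul, Real.norm_of_nonneg hr0, hr]; field_simp)
  rw [integral_add' (hFint z) (hFint (-z)), ← hsymm, integral_const_mul] at hle
  simp only [hx]
  have hn' : (0 : ℝ) < n := by positivity
  calc _ ≤ 2 * (‖w‖ ^ 2 / (3 * n)) := by linarith
    _ = 2 / (3 * n) * ‖w‖ ^ 2 := by ring
    _ ≤ _ := by gcongr

lemma alphaSigma_pos : 0 < alphaSigma := by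
  have h := Real.sin_lt (x := Real.pi / 8) (by positivity)
  have hpi := Real.pi_pos
  rw [alphaSigma, sub_pos, div_lt_div_iff₀ hpi two_pos]
  linarith

/-- Jordan's inequality `sin t ≥ 2t / π` at `π / 8`, together with `π ≤ 4`, even gives `1 / 4`. -/
lemma alphaSigma_le : alphaSigma ≤ 1 / 3 := by
  have hpi := Real.pi_pos
  have h := Real.mul_le_sin (x := Real.pi / 8) (by positivity) (by linarith)
  have h' : 2 / Real.pi * (Real.pi / 8) = 1 / 4 := by field_simp; norm_num
  have h4 := Real.pi_le_four
  have : 1 / 4 ≤ 4 * Real.sin (Real.pi / 8) / Real.pi := by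
    rw [le_div_iff₀ hpi]
    linarith
  rw [alphaSigma]
  linarith

lemma one_sub_alphaSigma_div_nonneg (hn : n ≠ 0) : 0 ≤ 1 - alphaSigma / n := by
  have hn' : (1 : ℝ) ≤ n := by exact_mod_cast Nat.one_le_iff_ne_zero.2 hn
  have := div_le_self alphaSigma_pos.le hn'
  linarith [alphaSigma_le]

/-- One Kaczmarz step from a point of the basin contracts the expected squared error. -/
lemma integral_norm_update_sub_sq_le (hn : n ≠ 0) {x z : Vec n} (hz : z ∈ basin x) :
    Integrable (fun a => ‖update x a z - x‖ ^ 2) (sigma n) ∧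
    ∫ a, ‖update x a z - x‖ ^ 2 ∂sigma n ≤ (1 - alphaSigma / n) * ‖z - x‖ ^ 2 := by
  have := isProbabilityMeasure_sigma hn
  have h1 : Integrable (fun a : USphere n => ‖z - x‖ ^ 2 - inner ℝ (a : Vec n) (z - x) ^ 2)
      (sigma n) := integrable_sigma_of_continuous hn (by fun_prop)
  have h2 := integrable_sign_mul_abs_sub_sq hn x z
  simp only [norm_update_sub_sq]
  refine ⟨h1.add h2, ?_⟩
  rw [integral_add h1 h2, integral_sub (integrable_const _)
    (integrable_sigma_of_continuous hn (by fun_prop)), integral_inner_sq hn]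
  have h3 := integral_sign_mul_abs_sub_sq_le hn hz
  have hn' : (0 : ℝ) < n := by positivity
  have h4 : alphaSigma / n * ‖z - x‖ ^ 2 ≤ 1 / 3 / n * ‖z - x‖ ^ 2 := by
    gcongr
    exact alphaSigma_le
  have h5 : 2 / (3 * n) * ‖z - x‖ ^ 2 = ‖z - x‖ ^ 2 / n - 1 / 3 / n * ‖z - x‖ ^ 2 := by
    field_simp
    ring
  simp only [integral_const, probReal_univ, one_smul]
  linarith

lemma lintegral_norm_update_sub_sq_le (hn : n ≠ 0) {x z : Vec n} (hz : z ∈ basin x) :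
    ∫⁻ a, ENNReal.ofReal (‖update x a z - x‖ ^ 2) ∂sigma n ≤
      ENNReal.ofReal (1 - alphaSigma / n) * ENNReal.ofReal (‖z - x‖ ^ 2) := by
  obtain ⟨hint, hle⟩ := integral_norm_update_sub_sq_le hn hz
  rw [← ofReal_integral_eq_lintegral_ofReal hint (Filter.Eventually.of_forall fun a => sq_nonneg _),
    ← ENNReal.ofReal_mul (one_sub_alphaSigma_div_nonneg hn)]
  exact ENNReal.ofReal_le_ofReal hle

end Step

/-! ### Stopped iterates, independence, and passage to the exit time. -/

section Iterates

variable {n : ℕ} {Ω : Type*}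

open scoped Classical in
/-- A Kaczmarz step that is frozen outside the basin. -/
noncomputable def stoppedUpdate (x : Vec n) (a : USphere n) (z : Vec n) : Vec n :=
  if z ∈ basin x then update x a z else z

/-- The Kaczmarz iterates, stopped at the exit time from the basin. -/
noncomputable def stoppedIterate (x x₀ : Vec n) (a : ℕ → Ω → USphere n) : ℕ → Ω → Vec n
  | 0, _ => x₀
  | k + 1, ω => stoppedUpdate x (a k ω) (stoppedIterate x x₀ a k ω)

lemma measurable_stoppedUpdate_comp {m : MeasurableSpace Ω} {f : Ω → Vec n} {b : Ω → USphere n}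
    (hf : Measurable f) (hb : Measurable b) (x : Vec n) :
    Measurable fun ω => stoppedUpdate x (b ω) (f ω) := by
  have h : Measurable fun ω => update x (b ω) (f ω) := (measurable_update x).comp (hf.prodMk hb)
  exact Measurable.ite (hf (measurableSet_basin x)) h hf

lemma measurable_stoppedUpdate (x : Vec n) :
    Measurable fun y : Vec n × USphere n => stoppedUpdate x y.2 y.1 :=
  measurable_stoppedUpdate_comp measurable_fst measurable_snd x

lemma stoppedIterate_eq_iterate {x x₀ : Vec n} {a : ℕ → Ω → USphere n} {ω : Ω} {k : ℕ}
    (h : ∀ j < k, iterate x x₀ a j ω ∈ basin x) :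
    stoppedIterate x x₀ a k ω = iterate x x₀ a k ω := by
  induction k with
  | zero => rfl
  | succ k ih =>
    rw [stoppedIterate, iterate, ih fun j hj => h j (by omega), stoppedUpdate,
      if_pos (h k (by omega))]

lemma exitTime_eq_top_iff {x x₀ : Vec n} {a : ℕ → Ω → USphere n} {ω : Ω} :
    exitTime x x₀ a ω = ⊤ ↔ ∀ k, iterate x x₀ a k ω ∈ basin x := by
  simp [exitTime, hittingAfter_eq_top_iff]

lemma exitTime_lt_top_iff {x x₀ : Vec n} {a : ℕ → Ω → USphere n} {ω : Ω} :
    exitTime x x₀ a ω < ⊤ ↔ ∃ k, stoppedIterate x x₀ a k ω ∉ basin x := by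
  rw [lt_top_iff_ne_top, ne_eq, exitTime_eq_top_iff, ← not_forall, not_iff_not]
  constructor
  · intro h k
    rw [stoppedIterate_eq_iterate fun j _ => h j]
    exact h k
  · intro h k
    induction k using Nat.strong_induction_on with
    | _ k ih =>
      rw [← stoppedIterate_eq_iterate ih]
      exact h k

/-- A frozen point never returns, so the probability of ever leaving is the supremum over single
times. -/
lemma stoppedIterate_notMem_mono {x x₀ : Vec n} {a : ℕ → Ω → USphere n} :
    Monotone fun k => {ω | stoppedIterate x x₀ a k ω ∉ basin x} := by
  refine monotone_nat_of_le_succ fun k ω (h : _ ∉ _) => ?_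
  change stoppedUpdate x (a k ω) (stoppedIterate x x₀ a k ω) ∉ basin x
  rwa [stoppedUpdate, if_neg h]

lemma measurable_iterate [MeasurableSpace Ω] (x x₀ : Vec n) {a : ℕ → Ω → USphere n}
    (ha : ∀ k, Measurable (a k)) (k : ℕ) : Measurable (iterate x x₀ a k) := by
  induction k with
  | zero => exact measurable_const
  | succ k ih => exact (measurable_update x).comp (ih.prodMk (ha k))

/-- The `k`-th iterate uses only the vectors with index below `k`; hence its independence of `a k`.
-/
lemma measurable_stoppedIterate (x x₀ : Vec n) (a : ℕ → Ω → USphere n) (k : ℕ) :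
    Measurable[⨆ i ∈ Set.Iio k, MeasurableSpace.comap (a i) inferInstance]
      (stoppedIterate x x₀ a k) := by
  induction k with
  | zero => exact measurable_const
  | succ k ih =>
    have h1 : Measurable[⨆ i ∈ Set.Iio (k + 1), MeasurableSpace.comap (a i) inferInstance]
        (stoppedIterate x x₀ a k) :=
      ih.mono (biSup_mono fun i (hi : i < k) => Nat.lt_succ_of_lt hi) le_rfl
    have h2 : Measurable[⨆ i ∈ Set.Iio (k + 1), MeasurableSpace.comap (a i) inferInstance]
        (a k) :=
      (comap_measurable (a k)).mono
        (le_biSup (fun i => MeasurableSpace.comap (a i) inferInstance)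
          (Set.mem_Iio.2 (Nat.lt_succ_self k))) le_rfl
    exact measurable_stoppedUpdate_comp h1 h2 x

variable [MeasurableSpace Ω] {P : Measure Ω}

lemma measurable_stoppedIterate' (x x₀ : Vec n) {a : ℕ → Ω → USphere n}
    (ha : ∀ k, Measurable (a k)) (k : ℕ) : Measurable (stoppedIterate x x₀ a k) :=
  (measurable_stoppedIterate x x₀ a k).mono (iSup₂_le fun i _ => (ha i).comap_le) le_rfl

lemma indepFun_stoppedIterate (x x₀ : Vec n) {a : ℕ → Ω → USphere n}
    (ha : ∀ k, Measurable (a k)) (ha_indep : iIndepFun a P) (k : ℕ) :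
    IndepFun (stoppedIterate x x₀ a k) (a k) P := by
  rw [IndepFun_iff_Indep]
  refine indep_of_indep_of_le (indep_iSup_of_disjoint (fun i => (ha i).comap_le) ha_indep.iIndep
    (S := Set.Iio k) (T := {k}) (by simp)) (measurable_stoppedIterate x x₀ a k).comap_le ?_
  exact le_biSup (fun i => MeasurableSpace.comap (a i) inferInstance) (Set.mem_singleton k)

/-- A functional contracted on average by one stopped step decays geometrically along the stopped
iterates. -/
lemma lintegral_stoppedIterate_le [IsProbabilityMeasure P] {x : Vec n} (x₀ : Vec n)
    {a : ℕ → Ω → USphere n} (ha : ∀ k, Measurable (a k)) (ha_indep : iIndepFun a P)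
    (ha_unif : ∀ k, P.map (a k) = sigma n) {G : Vec n → ENNReal} (hG : Measurable G) {c : ENNReal}
    (hstep : ∀ z, ∫⁻ a, G (stoppedUpdate x a z) ∂sigma n ≤ c * G z) (k : ℕ) :
    ∫⁻ ω, G (stoppedIterate x x₀ a k ω) ∂P ≤ c ^ k * G x₀ := by
  induction k with
  | zero => simp [stoppedIterate]
  | succ k ih =>
    have hY := measurable_stoppedIterate' x x₀ ha k
    have hGT : Measurable fun y : Vec n × USphere n => G (stoppedUpdate x y.2 y.1) :=
      hG.comp (measurable_stoppedUpdate x)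
    have : IsProbabilityMeasure (sigma n) :=
      ha_unif k ▸ Measure.isProbabilityMeasure_map (ha k).aemeasurable
    calc ∫⁻ ω, G (stoppedIterate x x₀ a (k + 1) ω) ∂P
        = ∫⁻ y, G (stoppedUpdate x y.2 y.1)
            ∂(P.map fun ω => (stoppedIterate x x₀ a k ω, a k ω)) := by
          rw [lintegral_map hGT (hY.prodMk (ha k))]
          rfl
      _ = ∫⁻ z, ∫⁻ b, G (stoppedUpdate x b z) ∂sigma n ∂(P.map (stoppedIterate x x₀ a k)) := by
          rw [(indepFun_iff_map_prod_eq_prod_map_map hY.aemeasurable (ha k).aemeasurable).1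
            (indepFun_stoppedIterate x x₀ ha ha_indep k), ha_unif k,
            lintegral_prod _ hGT.aemeasurable]
      _ ≤ ∫⁻ z, c * G z ∂(P.map (stoppedIterate x x₀ a k)) := lintegral_mono hstep
      _ = c * ∫⁻ ω, G (stoppedIterate x x₀ a k ω) ∂P := by
          rw [lintegral_const_mul _ hG, lintegral_map hG hY]
      _ ≤ c * (c ^ k * G x₀) := by gcongr
      _ = c ^ (k + 1) * G x₀ := by ring

lemma measurable_ofReal_norm_sub_sq (x : Vec n) :
    Measurable fun z : Vec n => ENNReal.ofReal (‖z - x‖ ^ 2) :=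
  ((measurable_id.sub_const x).norm.pow_const 2).ennreal_ofReal

lemma lintegral_stoppedUpdate_le (hn : n ≠ 0) (x z : Vec n) :
    ∫⁻ a, ENNReal.ofReal (‖stoppedUpdate x a z - x‖ ^ 2) ∂sigma n ≤
      1 * ENNReal.ofReal (‖z - x‖ ^ 2) := by
  have := isProbabilityMeasure_sigma hn
  by_cases hz : z ∈ basin x
  · simp only [stoppedUpdate, if_pos hz]
    refine (lintegral_norm_update_sub_sq_le hn hz).trans ?_
    gcongr
    rw [← ENNReal.ofReal_one]
    refine ENNReal.ofReal_le_ofReal ?_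
    have : 0 ≤ alphaSigma / n := div_nonneg alphaSigma_pos.le (Nat.cast_nonneg n)
    linarith
  · simp [stoppedUpdate, if_neg hz]

/-- Frozen points do not contract, but the indicator makes them contribute zero; for `z` in the
basin the indicator of the new point is simply dropped. -/
lemma lintegral_indicator_stoppedUpdate_le (hn : n ≠ 0) (x z : Vec n) :
    ∫⁻ a, (basin x).indicator (fun y => ENNReal.ofReal (‖y - x‖ ^ 2)) (stoppedUpdate x a z)
        ∂sigma n ≤
      ENNReal.ofReal (1 - alphaSigma / n) *
        (basin x).indicator (fun y => ENNReal.ofReal (‖y - x‖ ^ 2)) z := by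
  by_cases hz : z ∈ basin x
  · rw [Set.indicator_of_mem hz]
    refine (lintegral_mono fun a => Set.indicator_le_self _ _ _).trans ?_
    simp only [stoppedUpdate, if_pos hz]
    exact lintegral_norm_update_sub_sq_le hn hz
  · simp only [stoppedUpdate, if_neg hz, Set.indicator_of_notMem hz, lintegral_zero, zero_le]

lemma measurableSet_exitTime_eq_top (x x₀ : Vec n) {a : ℕ → Ω → USphere n}
    (ha : ∀ k, Measurable (a k)) : MeasurableSet {ω | exitTime x x₀ a ω = ⊤} := by
  have : {ω | exitTime x x₀ a ω = ⊤} = ⋂ k, iterate x x₀ a k ⁻¹' basin x := by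
    ext ω
    simp [exitTime_eq_top_iff]
  rw [this]
  exact MeasurableSet.iInter fun k => measurable_iterate x x₀ ha k (measurableSet_basin x)

lemma lintegral_indicator_norm_iterate_sub_sq_le [IsProbabilityMeasure P] (hn : n ≠ 0)
    (x x₀ : Vec n) {a : ℕ → Ω → USphere n} (ha : ∀ k, Measurable (a k))
    (ha_indep : iIndepFun a P) (ha_unif : ∀ k, P.map (a k) = sigma n) (k : ℕ) :
    ∫⁻ ω, ENNReal.ofReal ({ω | exitTime x x₀ a ω = ⊤}.indicator
      (fun ω => ‖iterate x x₀ a k ω - x‖ ^ 2) ω) ∂P ≤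
      ENNReal.ofReal ((1 - alphaSigma / n) ^ k * ‖x₀ - x‖ ^ 2) := by
  have hρ := one_sub_alphaSigma_div_nonneg hn
  calc _ ≤ ∫⁻ ω, (basin x).indicator (fun y => ENNReal.ofReal (‖y - x‖ ^ 2))
        (stoppedIterate x x₀ a k ω) ∂P := by
        refine lintegral_mono fun ω => ?_
        by_cases hω : exitTime x x₀ a ω = ⊤
        · rw [Set.indicator_of_mem (show ω ∈ {ω | exitTime x x₀ a ω = ⊤} from hω)]
          rw [exitTime_eq_top_iff] at hω
          rw [stoppedIterate_eq_iterate fun j _ => hω j, Set.indicator_of_mem (hω k)]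
        · rw [Set.indicator_of_notMem (show ω ∉ {ω | exitTime x x₀ a ω = ⊤} from hω)]
          simp
    _ ≤ ENNReal.ofReal (1 - alphaSigma / n) ^ k *
        (basin x).indicator (fun y => ENNReal.ofReal (‖y - x‖ ^ 2)) x₀ :=
      lintegral_stoppedIterate_le x₀ ha ha_indep ha_unif
        ((measurable_ofReal_norm_sub_sq x).indicator (measurableSet_basin x))
        (lintegral_indicator_stoppedUpdate_le hn x) k
    _ ≤ ENNReal.ofReal (1 - alphaSigma / n) ^ k * ENNReal.ofReal (‖x₀ - x‖ ^ 2) := by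
      gcongr
      exact Set.indicator_le_self _ _ _
    _ = _ := by rw [ENNReal.ofReal_mul (pow_nonneg hρ k), ENNReal.ofReal_pow hρ]

lemma sin_sq_mul_measure_exitTime_lt_top_le [IsProbabilityMeasure P] (hn : n ≠ 0)
    (x x₀ : Vec n) {a : ℕ → Ω → USphere n} (ha : ∀ k, Measurable (a k))
    (ha_indep : iIndepFun a P) (ha_unif : ∀ k, P.map (a k) = sigma n) :
    ENNReal.ofReal ((Real.sin (Real.pi / 8) * ‖x‖) ^ 2) * P {ω | exitTime x x₀ a ω < ⊤} ≤
      ENNReal.ofReal (‖x₀ - x‖ ^ 2) := by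
  have h : {ω | exitTime x x₀ a ω < ⊤} = ⋃ k, {ω | stoppedIterate x x₀ a k ω ∉ basin x} := by
    ext ω
    simp [exitTime_lt_top_iff]
  rw [h, stoppedIterate_notMem_mono.measure_iUnion, ENNReal.mul_iSup]
  refine iSup_le fun k => ?_
  -- Markov's inequality at the single time `k`, with a bound independent of `k`.
  calc _ ≤ ENNReal.ofReal ((Real.sin (Real.pi / 8) * ‖x‖) ^ 2) *
        P {ω | ENNReal.ofReal ((Real.sin (Real.pi / 8) * ‖x‖) ^ 2) ≤
          ENNReal.ofReal (‖stoppedIterate x x₀ a k ω - x‖ ^ 2)} := by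
        gcongr with ω
        exact fun hω => ENNReal.ofReal_le_ofReal (sin_mul_norm_le_of_notMem_basin hω)
    _ ≤ ∫⁻ ω, ENNReal.ofReal (‖stoppedIterate x x₀ a k ω - x‖ ^ 2) ∂P :=
      mul_meas_ge_le_lintegral ((measurable_ofReal_norm_sub_sq x).comp
        (measurable_stoppedIterate' x x₀ ha k)) _
    _ ≤ 1 ^ k * ENNReal.ofReal (‖x₀ - x‖ ^ 2) :=
      lintegral_stoppedIterate_le x₀ ha ha_indep ha_unif (measurable_ofReal_norm_sub_sq x)
        (lintegral_stoppedUpdate_le hn x) k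
    _ = _ := by rw [one_pow, one_mul]

end Iterates

end Kaczmarz

/-! ### Conversion of the extended nonnegative estimates to real ones. -/

theorem mainTheorem5 {n : ℕ} {Ω : Type*} [MeasurableSpace Ω] (P : Measure Ω)
    [IsProbabilityMeasure P] (x x₀ : Kaczmarz.Vec n) (hx : x ≠ 0) (δ : ℝ) (hδ : 0 < δ)
    (hx₀ : ‖x₀ - x‖ ≤ δ * ‖x‖) (a : ℕ → Ω → Kaczmarz.USphere n)
    (ha_meas : ∀ k, Measurable (a k)) (ha_indep : iIndepFun a P)
    (ha_unif : ∀ k, P.map (a k) = Kaczmarz.sigma n) :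
    0 < Kaczmarz.alphaSigma ∧
    (∀ k : ℕ,
      Integrable ({ω | Kaczmarz.exitTime x x₀ a ω = ⊤}.indicator
        fun ω => ‖Kaczmarz.iterate x x₀ a k ω - x‖ ^ 2) P ∧
      ∫ ω, {ω | Kaczmarz.exitTime x x₀ a ω = ⊤}.indicator
        (fun ω => ‖Kaczmarz.iterate x x₀ a k ω - x‖ ^ 2) ω ∂P
        ≤ (1 - Kaczmarz.alphaSigma / n) ^ k * ‖x₀ - x‖ ^ 2) ∧
    P.real {ω | Kaczmarz.exitTime x x₀ a ω < ⊤} ≤ (δ / Real.sin (Real.pi / 8)) ^ 2 := by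
  have hn : n ≠ 0 := by
    rintro rfl
    exact hx (Subsingleton.elim _ _)
  refine ⟨Kaczmarz.alphaSigma_pos, fun k => ?_, ?_⟩
  · have hle := Kaczmarz.lintegral_indicator_norm_iterate_sub_sq_le hn x x₀ ha_meas ha_indep
      ha_unif k
    have hmeas : AEStronglyMeasurable ({ω | Kaczmarz.exitTime x x₀ a ω = ⊤}.indicator
        fun ω => ‖Kaczmarz.iterate x x₀ a k ω - x‖ ^ 2) P :=
      ((((Kaczmarz.measurable_iterate x x₀ ha_meas k).sub_const x).norm.pow_const 2).indicator
        (Kaczmarz.measurableSet_exitTime_eq_top x x₀ ha_meas)).aestronglyMeasurable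
    have hnonneg : 0 ≤ᵐ[P] {ω | Kaczmarz.exitTime x x₀ a ω = ⊤}.indicator
        fun ω => ‖Kaczmarz.iterate x x₀ a k ω - x‖ ^ 2 :=
      Filter.Eventually.of_forall fun ω => Set.indicator_nonneg (fun _ _ => sq_nonneg _) ω
    refine ⟨⟨hmeas, (hasFiniteIntegral_iff_ofReal hnonneg).2
      (hle.trans_lt ENNReal.ofReal_lt_top)⟩, ?_⟩
    rw [integral_eq_lintegral_of_nonneg_ae hnonneg hmeas]
    exact ENNReal.toReal_le_of_le_ofReal (mul_nonneg
      (pow_nonneg (Kaczmarz.one_sub_alphaSigma_div_nonneg hn) k) (sq_nonneg _)) hle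
  · have hle := Kaczmarz.sin_sq_mul_measure_exitTime_lt_top_le hn x x₀ ha_meas ha_indep ha_unif
    have hpi := Real.pi_pos
    have hsin : 0 < Real.sin (Real.pi / 8) :=
      Real.sin_pos_of_pos_of_lt_pi (by positivity) (by linarith)
    have hxn : 0 < ‖x‖ := norm_pos_iff.2 hx
    have hreal := ENNReal.toReal_mono ENNReal.ofReal_ne_top hle
    rw [ENNReal.toReal_mul, ENNReal.toReal_ofReal (sq_nonneg _),
      ENNReal.toReal_ofReal (sq_nonneg _)] at hreal
    have hsq : ‖x₀ - x‖ ^ 2 ≤ (δ * ‖x‖) ^ 2 := by gcongr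
    rw [div_pow, le_div_iff₀ (by positivity)]
    refine le_of_mul_le_mul_right ?_ (by positivity : 0 < ‖x‖ ^ 2)
    rw [← mul_pow δ]
    refine le_trans (le_of_eq ?_) (hreal.trans hsq)
    rw [Measure.real]
    ring
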